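/- Let $d\in\mathbb N$ and $T>0$, and let $\mathcal P$ be the set of Borel probability measures on $\mathbb R^d$ with the topology of weak convergence. For $i,j\in\{1,\dots,d\}$ let $a_{ij},b_i:[0,T]\times\mathbb R^d\to\mathbb R$ be Borel measurable, globally bounded, and continuous in $x\in\mathbb R^d$ for each $t\in[0,T]$, and suppose that the matrix $(a_{ij}(t,x))_{i,j\le d}$ is symmetric and non-negative definite for every $(t,x)\in[0,T]\times\mathbb R^d$. Put $$L_tf(x)=\tfrac12\sum_{i,j=1}^d a_{ij}(t,x)\,\partial_i\partial_jf(x)+\sum_{i=1}^d b_i(t,x)\,\partial_if(x).$$ For $(s,\nu)\in[0,T]\times\mathcal P$ let $FP(s,\nu)$ be the set of narrowly continuous probability solutions of the Fokker–Planck–Kolmogorov (FPK) equation $\partial_t\mu_t=L_t^*\mu_t$, $\mu_s=\nu$, i.e. the set of all continuous curves $(\mu_t)_{t\in[s,T]}\in C([s,T],\mathcal P)$ with $\mu_s=\nu$ such that $$\int_{\mathbb R^d} f\,d\mu_t-\int_{\mathbb R^d} f\,d\nu=\int_s^t\int_{\mathbb R^d}L_uf(x)\,d\mu_u(x)\,du$$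 for all smooth, compactly supported $f:\mathbb R^d\to\mathbb R$ and all $t\in[s,T]$. Assume that $FP(s,\nu)\neq\emptyset$ for every $(s,\nu)\in[0,T]\times\mathcal P$. Then the following are equivalent: (i) The FPK equation is well-posed among narrowly continuous probability solutions, i.e. $|FP(s,\nu)|=1$ for all $(s,\nu)\in[0,T]\times\mathcal P$. (ii) There is exactly one family $(\mu^{s,\nu})_{(s,\nu)\in[0,T]\times\mathcal P}$ with $\mu^{s,\nu}\in FP(s,\nu)$ for every $(s,\nu)$ that has the flow property $$\mu^{s,\nu}_t=\mu^{r,\mu^{s,\nu}_r}_t\qquad\text{for all }0\le s\le r\le t\le T\text{ and }\nu\in\mathcal P.$$ -/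

import Mathlib

open MeasureTheory
open scoped ContDiff

noncomputable section

namespace FPK

/-- The state space `ℝ^d` with its Euclidean structure. -/
abbrev Space (d : ℕ) : Type := EuclideanSpace ℝ (Fin d)

/-- The set `𝓟` of Borel probability measures on `ℝ^d`; Mathlib's topology on it is that of weak
(narrow) convergence. -/
abbrev Prob (d : ℕ) : Type := ProbabilityMeasure (Space d)

/-- The spatial partial derivative `∂ᵢ f`. -/
def partialDeriv {d : ℕ} (i : Fin d) (f : Space d → ℝ) (x : Space d) : ℝ :=
  fderiv ℝ f x (EuclideanSpace.single i 1)

/-- The Kolmogorov operator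
`L_t f (x) = ½ ∑ᵢⱼ aᵢⱼ(t,x) ∂ᵢ∂ⱼ f(x) + ∑ᵢ bᵢ(t,x) ∂ᵢ f(x)`. -/
def kolmogorov {d : ℕ} (A : ℝ → Space d → Matrix (Fin d) (Fin d) ℝ)
    (b : ℝ → Space d → Fin d → ℝ) (t : ℝ) (f : Space d → ℝ) (x : Space d) : ℝ :=
  (1 / 2) * ∑ i, ∑ j, A t x i j * partialDeriv i (partialDeriv j f) x
    + ∑ i, b t x i * partialDeriv i f x

/-- The standing assumptions on the coefficients on `[0,T] × ℝ^d`: jointly Borel measurable,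
continuous in the space variable, globally bounded, with `A(t,x)` symmetric and non-negative
definite. The values at times outside `[0,T]` are irrelevant and unrestricted. -/
structure IsAdmissible {d : ℕ} (T : ℝ) (A : ℝ → Space d → Matrix (Fin d) (Fin d) ℝ)
    (b : ℝ → Space d → Fin d → ℝ) : Prop where
  measurable_diffusion : ∀ i j,
    Measurable fun p : Set.Icc (0 : ℝ) T × Space d => A (p.1 : ℝ) p.2 i j
  measurable_drift : ∀ i,
    Measurable fun p : Set.Icc (0 : ℝ) T × Space d => b (p.1 : ℝ) p.2 i
  continuous_diffusion : ∀ t ∈ Set.Icc (0 : ℝ) T, ∀ i j, Continuous fun x => A t x i j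
  continuous_drift : ∀ t ∈ Set.Icc (0 : ℝ) T, ∀ i, Continuous fun x => b t x i
  bounded_diffusion : ∃ C : ℝ, ∀ t ∈ Set.Icc (0 : ℝ) T, ∀ x i j, |A t x i j| ≤ C
  bounded_drift : ∃ C : ℝ, ∀ t ∈ Set.Icc (0 : ℝ) T, ∀ x i, |b t x i| ≤ C
  posSemidef : ∀ t ∈ Set.Icc (0 : ℝ) T, ∀ x, (A t x).PosSemidef

/-- The set `FP(s,ν)` of narrowly continuous probability solutions `(μ_t)_{t ∈ [s,T]}` of the
Fokker-Planck-Kolmogorov equation with initial condition `(s,ν)`: the curves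
`μ ∈ C([s,T], 𝓟)` with `μ_s = ν` and
`∫ f dμ_t - ∫ f dν = ∫_s^t ∫ L_u f dμ_u du` for all `f ∈ C₀^∞(ℝ^d)` and `t ∈ [s,T]`.
In the time integral, `Set.projIcc` only rewrites `u ∈ [s,t]` as an element of `[s,T]`. -/
def FP {d : ℕ} {T : ℝ} (A : ℝ → Space d → Matrix (Fin d) (Fin d) ℝ)
    (b : ℝ → Space d → Fin d → ℝ) (s : Set.Icc (0 : ℝ) T) (ν : Prob d) :
    Set C(Set.Icc (s : ℝ) T, Prob d) :=
  {μ | μ ⟨(s : ℝ), Set.left_mem_Icc.2 s.2.2⟩ = ν ∧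
    ∀ f : Space d → ℝ, ContDiff ℝ ∞ f → HasCompactSupport f →
      ∀ t : Set.Icc (s : ℝ) T,
        ∫ x, f x ∂(μ t : Measure (Space d)) - ∫ x, f x ∂(ν : Measure (Space d)) =
          ∫ u in (s : ℝ)..(t : ℝ),
            ∫ x, kolmogorov A b u f x ∂(μ (Set.projIcc (s : ℝ) T s.2.2 u) : Measure (Space d))}

/-- The families `(γ^{s,ν})` of narrowly continuous curves of probability measures on `[s,T]`,
indexed by all initial conditions `(s,ν) ∈ [0,T] × 𝓟`. -/
abbrev CurveFamily (d : ℕ) (T : ℝ) : Type :=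
  (s : Set.Icc (0 : ℝ) T) → Prob d → C(Set.Icc (s : ℝ) T, Prob d)

/-- `γ` is a family of solutions, `γ^{s,ν} ∈ FP(s,ν)` for all `(s,ν)`, with the flow property
`γ^{s,ν}_t = γ^{r,γ^{s,ν}_r}_t` for all `0 ≤ s ≤ r ≤ t ≤ T` and all `ν`. -/
structure IsFlow {d : ℕ} {T : ℝ} (A : ℝ → Space d → Matrix (Fin d) (Fin d) ℝ)
    (b : ℝ → Space d → Fin d → ℝ) (γ : CurveFamily d T) : Prop where
  mem_FP : ∀ s ν, γ s ν ∈ FP A b s ν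
  flow : ∀ (s r t : Set.Icc (0 : ℝ) T) (hsr : s ≤ r) (hrt : r ≤ t) (ν : Prob d),
    γ s ν ⟨(t : ℝ), hsr.trans hrt, t.2.2⟩ =
      γ r (γ s ν ⟨(r : ℝ), hsr, r.2.2⟩) ⟨(t : ℝ), hrt, t.2.2⟩

end FPK

end

/-! The substantial direction is that a unique flow forces well-posedness. If two solutions from
`(s, ν)` differ at time `t`, some test function `f` separates them in `∫ f dμ_t`. One flow maximizes
this integral from all initial data at once, another minimizes it
(`IsAdmissible.exists_isFlow_maximizing`). If there is only one flow, maximum and minimum agree: a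
contradiction. Conversely, well-posedness makes a flow unique, and its existence comes from the same
selection.

The selection is of Markov type. In `IsStable` families, maximizing a continuous functional at a
fixed time preserves stability, by dynamic programming (`IsStable.maximizers`). A minimal stable
family, given by Zorn's lemma, therefore has one curve per initial datum, and stability under
restriction is then the flow property (`IsStable.exists_flow`).

It remains that solutions form a stable family. The analytic point is compactness for pointwise
convergence (`IsAdmissible.isCompact_solutions`): bounded coefficients give tightness and a
Lipschitz bound in time for each test integral, and continuity in `x` lets the equation pass to
limits. -/

namespace FPK

open Set Filter Topology

/-! ### Abstract selection of flows -/

section Selection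

variable {T : ℝ} {X : Type*}

/-- Follow `c` up to time `r` and `c'` afterwards. -/
noncomputable def concat (r : ℝ) (c c' : ℝ → X) (t : ℝ) : X := if t ≤ r then c t else c' t

lemma concat_of_le {r t : ℝ} (c c' : ℝ → X) (h : t ≤ r) : concat r c c' t = c t := if_pos h

lemma concat_of_lt {r t : ℝ} (c c' : ℝ → X) (h : r < t) : concat r c c' t = c' t :=
  if_neg h.not_ge

/-- A relation between initial data `(s, x)` and curves started from `x` at time `s`, with
non-empty compact sections (for pointwise convergence), stable under restriction to later starting
times and under concatenation. -/
structure IsStable [TopologicalSpace X] (K : Set (Icc (0 : ℝ) T × X × (ℝ → X))) : Prop where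
  eq_of_le : ∀ {s x c}, (s, x, c) ∈ K → ∀ t : ℝ, t ≤ s → c t = x
  isCompact : ∀ s x, IsCompact {c | (s, x, c) ∈ K}
  nonempty : ∀ s x, {c | (s, x, c) ∈ K}.Nonempty
  restrict : ∀ {s x c}, (s, x, c) ∈ K → ∀ r : Icc (0 : ℝ) T, s ≤ r →
    (r, c r, fun t => c (max r t)) ∈ K
  concat : ∀ {s x c c'} {r : Icc (0 : ℝ) T}, (s, x, c) ∈ K → s ≤ r → (r, c r, c') ∈ K →
    (s, x, concat r c c') ∈ K

/-- The curves in `K` that maximize `J` at time `q` among those with the same initial data. -/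
def maximizers (K : Set (Icc (0 : ℝ) T × X × (ℝ → X))) (q : ℝ) (J : X → ℝ) :
    Set (Icc (0 : ℝ) T × X × (ℝ → X)) :=
  {p | p ∈ K ∧ ∀ c', (p.1, p.2.1, c') ∈ K → J (c' q) ≤ J (p.2.2 q)}

lemma mem_maximizers {K : Set (Icc (0 : ℝ) T × X × (ℝ → X))} {q : ℝ} {J : X → ℝ} {s x c} :
    (s, x, c) ∈ maximizers K q J ↔
      (s, x, c) ∈ K ∧ ∀ c', (s, x, c') ∈ K → J (c' q) ≤ J (c q) := Iff.rfl

lemma maximizers_subset (K : Set (Icc (0 : ℝ) T × X × (ℝ → X))) (q : ℝ) (J : X → ℝ) :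
    maximizers K q J ⊆ K := fun _ h => h.1

variable [TopologicalSpace X]

/-- Dynamic programming. Only `q > r` matters, since curves from time `r` are constant up to `r`. A
better tail, concatenated to `c`, would beat `c`; conversely the tail of a maximizer `c` competes
with `c'`, so switching to `c'` loses nothing. -/
lemma IsStable.maximizers {K : Set (Icc (0 : ℝ) T × X × (ℝ → X))} (hK : IsStable K) (q : ℝ)
    {J : X → ℝ} (hJ : Continuous J) : IsStable (maximizers K q J) := by
  have hrestrict : ∀ {s x c}, (s, x, c) ∈ FPK.maximizers K q J → ∀ r : Icc (0 : ℝ) T, s ≤ r →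
      (r, c r, fun t => c (max r t)) ∈ FPK.maximizers K q J := by
    intro s x c h r hsr
    rw [mem_maximizers] at h ⊢
    refine ⟨hK.restrict h.1 r hsr, fun c' hc' => ?_⟩
    rcases le_or_gt q r with hq | hq
    · rw [hK.eq_of_le hc' q hq, max_eq_left hq]
    · have := h.2 _ (hK.concat h.1 hsr hc')
      simp only [max_eq_right hq.le]
      rwa [concat_of_lt _ _ hq] at this
  refine ⟨fun h => hK.eq_of_le h.1, fun s x => ?_, fun s x => ?_, hrestrict, ?_⟩
  · have : {c | (s, x, c) ∈ FPK.maximizers K q J} =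
        {c | (s, x, c) ∈ K} ∩ ⋂ c' ∈ {c' | (s, x, c') ∈ K}, {c | J (c' q) ≤ J (c q)} := by
      ext c; simp [mem_maximizers]
    rw [this]
    refine (hK.isCompact s x).inter_right (isClosed_biInter fun c' _ => ?_)
    exact isClosed_le continuous_const (hJ.comp (continuous_apply q))
  · obtain ⟨c, hc, hmax⟩ := (hK.isCompact s x).exists_isMaxOn (hK.nonempty s x)
      (hJ.comp (continuous_apply q)).continuousOn
    exact ⟨c, hc, fun c' hc' => hmax hc'⟩
  · intro s x c c' r hc hsr hc'
    rw [mem_maximizers] at hc hc' ⊢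
    refine ⟨hK.concat hc.1 hsr hc'.1, fun c₁ hc₁ => ?_⟩
    rcases le_or_gt q r with hq | hq
    · rw [concat_of_le _ _ hq]
      exact hc.2 _ hc₁
    · rw [concat_of_lt _ _ hq]
      refine (hc.2 _ hc₁).trans ?_
      have := hc'.2 _ (hK.restrict hc.1 r hsr)
      rwa [max_eq_right hq.le] at this

/-- The chain condition serves only non-emptiness: nested non-empty compact sections have a common
point. -/
lemma IsStable.sInter [T2Space X] {S : Set (Set (Icc (0 : ℝ) T × X × (ℝ → X)))}
    (hS : ∀ K ∈ S, IsStable K) (hchain : IsChain (· ⊆ ·) S) (hne : S.Nonempty) :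
    IsStable (⋂₀ S) := by
  obtain ⟨K₀, hK₀⟩ := hne
  have : Nonempty S := ⟨⟨K₀, hK₀⟩⟩
  have hsec : ∀ s x, {c | (s, x, c) ∈ ⋂₀ S} = ⋂ K : S, {c | (s, x, c) ∈ K.1} := by
    intro s x; ext c; simp
  refine ⟨fun h => (hS K₀ hK₀).eq_of_le (h K₀ hK₀), fun s x => ?_, fun s x => ?_,
    fun h r hsr K hK => (hS K hK).restrict (h K hK) r hsr,
    fun h hsr h' K hK => (hS K hK).concat (h K hK) hsr (h' K hK)⟩
  · rw [hsec]
    exact ((hS K₀ hK₀).isCompact s x).of_isClosed_subset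
      (isClosed_iInter fun K => ((hS K K.2).isCompact s x).isClosed)
      (iInter_subset (fun K : S => {c | (s, x, c) ∈ K.1}) ⟨K₀, hK₀⟩)
  · rw [hsec]
    refine IsCompact.nonempty_iInter_of_directed_nonempty_isCompact_isClosed _ ?_
      (fun K => (hS K K.2).nonempty s x) (fun K => (hS K K.2).isCompact s x)
      (fun K => ((hS K K.2).isCompact s x).isClosed)
    intro K K'
    rcases hchain.total K.2 K'.2 with h | h
    · exact ⟨K, fun c hc => hc, fun c hc => h hc⟩
    · exact ⟨K', fun c hc => h hc, fun c hc => hc⟩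

/-- Every stable family of curves contains a flow. -/
theorem IsStable.exists_flow [T2Space X] [NormalSpace X]
    {K : Set (Icc (0 : ℝ) T × X × (ℝ → X))} (hK : IsStable K) :
    ∃ g : Icc (0 : ℝ) T → X → ℝ → X, (∀ s x, (s, x, g s x) ∈ K) ∧
      ∀ s r : Icc (0 : ℝ) T, s ≤ r → ∀ x, g r (g s x r) = fun t => g s x (max r t) := by
  obtain ⟨m, hmK, hm⟩ := zorn_superset_nonempty
    {K : Set (Icc (0 : ℝ) T × X × (ℝ → X)) | IsStable K}
    (fun c hc hchain hne =>
      ⟨⋂₀ c, IsStable.sInter hc hchain hne, fun s hs => sInter_subset_of_mem hs⟩) K hK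
  have hst : IsStable m := hm.prop
  have huniq : ∀ {s x c c'}, (s, x, c) ∈ m → (s, x, c') ∈ m → c = c' := by
    intro s x c c' hc hc'
    funext t
    by_contra hne
    -- Urysohn: `J` is `0` at `c t` and `1` at `c' t`. By minimality `m` equals its own maximizers
    -- of `J`, so `c` is one, which would give `1 ≤ 0`.
    obtain ⟨J, h0, h1, -⟩ := exists_continuous_zero_one_of_isClosed (isClosed_singleton (x := c t))
      (isClosed_singleton (x := c' t)) (by simpa using hne)
    have hc₁ := hm.le_of_le (hst.maximizers t J.continuous) (maximizers_subset m t J) hc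
    have := hc₁.2 _ hc'
    simp only at this
    rw [h0 rfl, h1 rfl] at this
    simp at this
    linarith
  choose g hg using hst.nonempty
  exact ⟨g, fun s x => hmK (hg s x), fun s r hsr x => huniq (hg _ _) (hst.restrict (hg s x) r hsr)⟩

end Selection

end FPK

namespace FPK

open Set Filter Topology

/-! ### Test functions and narrow convergence -/

section TestFunctions

variable {d : ℕ}

/-- A smooth bump function on `ℝ^d`, equal to `1` on the unit ball and supported in the ball of
radius `2`. -/
noncomputable def bump (d : ℕ) : ContDiffBump (0 : Space d) := ⟨1, 2, one_pos, one_lt_two⟩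

/-- Smooth cutoff functions, equal to `1` on balls of radius `n + 1`. -/
noncomputable def cutoff (d n : ℕ) (x : Space d) : ℝ := bump d (((n : ℝ) + 1)⁻¹ • x)

lemma contDiff_bump : ContDiff ℝ ∞ (bump d : Space d → ℝ) := (bump d).contDiff

lemma contDiff_cutoff (n : ℕ) : ContDiff ℝ ∞ (cutoff d n) :=
  (bump d).contDiff.comp (contDiff_const_smul _)

lemma cutoff_mem_Icc (n : ℕ) (x : Space d) : cutoff d n x ∈ Icc (0 : ℝ) 1 :=
  ⟨(bump d).nonneg, (bump d).le_one⟩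

lemma cutoff_eq_zero {n : ℕ} {x : Space d} (hx : 2 * ((n : ℝ) + 1) ≤ ‖x‖) : cutoff d n x = 0 := by
  have hn : (0 : ℝ) < n + 1 := by positivity
  refine (bump d).zero_of_le_dist ?_
  rw [dist_zero_right, norm_smul, norm_inv, Real.norm_of_nonneg hn.le, ← div_eq_inv_mul,
    le_div_iff₀ hn]
  exact hx

lemma cutoff_eq_one {n : ℕ} {x : Space d} (hx : ‖x‖ ≤ (n : ℝ) + 1) : cutoff d n x = 1 := by
  have hn : (0 : ℝ) < n + 1 := by positivity
  refine (bump d).one_of_mem_closedBall ?_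
  rw [mem_closedBall_zero_iff, norm_smul, norm_inv, Real.norm_of_nonneg hn.le, ← div_eq_inv_mul,
    div_le_iff₀ hn]
  simpa [bump] using hx

lemma hasCompactSupport_cutoff (n : ℕ) : HasCompactSupport (cutoff d n) :=
  HasCompactSupport.intro (isCompact_closedBall (0 : Space d) (2 * ((n : ℝ) + 1))) fun x hx =>
    cutoff_eq_zero (by simpa using (not_le.1 (mt mem_closedBall_zero_iff.2 hx)).le)

lemma tendsto_cutoff (x : Space d) : Tendsto (fun n => cutoff d n x) atTop (𝓝 1) := by
  refine tendsto_const_nhds.congr' ?_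
  filter_upwards [eventually_ge_atTop ⌈‖x‖⌉₊] with n hn
  exact (cutoff_eq_one ((Nat.ceil_le.1 hn).trans (by linarith))).symm

/-- The indicator function of an open set is a bounded limit of test functions. -/
lemma exists_test_tendsto_indicator {U : Set (Space d)} (hU : IsOpen U) :
    ∃ h : ℕ → Space d → ℝ, (∀ n, ContDiff ℝ ∞ (h n)) ∧ (∀ n, HasCompactSupport (h n)) ∧
      (∀ n x, h n x ∈ Icc (0 : ℝ) 1) ∧
      ∀ x, Tendsto (fun n => h n x) atTop (𝓝 (U.indicator 1 x)) := by
  -- `g` is smooth and positive exactly on `U`, so `smoothTransition (n * g x)` is eventually `1` on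
  -- `U` and always `0` off it; the cutoff supplies compact support.
  obtain ⟨g, hgsupp, hg, hgrange⟩ := hU.exists_contDiff_support_eq (n := ⊤)
  refine ⟨fun n x => cutoff d n x * Real.smoothTransition (n * g x), fun n => ?_, fun n => ?_,
    fun n x => ?_, fun x => ?_⟩
  · exact (contDiff_cutoff n).mul (Real.smoothTransition.contDiff.comp (contDiff_const.mul hg))
  · exact (hasCompactSupport_cutoff n).mul_right
  · have h1 := cutoff_mem_Icc n x
    have h2 := Real.smoothTransition.nonneg (n * g x)
    have h3 := Real.smoothTransition.le_one (n * g x)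
    exact ⟨mul_nonneg h1.1 h2, mul_le_one₀ h1.2 h2 h3⟩
  · have hgx : 0 ≤ g x := (hgrange ⟨x, rfl⟩).1
    by_cases hx : x ∈ U
    · have hpos : 0 < g x := lt_of_le_of_ne hgx (Ne.symm (by
        rw [← hgsupp] at hx; exact hx))
      rw [indicator_of_mem hx, Pi.one_apply, ← mul_one (1 : ℝ)]
      refine (tendsto_cutoff x).mul (tendsto_const_nhds.congr' ?_)
      filter_upwards [eventually_ge_atTop ⌈(g x)⁻¹⌉₊] with n hn
      refine (Real.smoothTransition.one_of_one_le ?_).symm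
      have := Nat.ceil_le.1 hn
      rwa [inv_le_iff_one_le_mul₀ hpos] at this
    · have h0 : g x = 0 := by
        rw [← hgsupp, Function.mem_support, not_not] at hx; exact hx
      simp [indicator_of_notMem hx, h0]

lemma tendsto_integral_indicator {U : Set (Space d)} (hU : IsOpen U) {h : ℕ → Space d → ℝ}
    (hc : ∀ n, Continuous (h n)) (hb : ∀ n x, h n x ∈ Icc (0 : ℝ) 1)
    (hlim : ∀ x, Tendsto (fun n => h n x) atTop (𝓝 (U.indicator 1 x)))
    (μ : Measure (Space d)) [IsFiniteMeasure μ] :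
    Tendsto (fun n => ∫ x, h n x ∂μ) atTop (𝓝 (μ.real U)) := by
  rw [← integral_indicator_one hU.measurableSet]
  refine tendsto_integral_of_dominated_convergence (fun _ => 1)
    (fun n => (hc n).aestronglyMeasurable) (integrable_const _) (fun n => ?_)
    (Eventually.of_forall hlim)
  refine Eventually.of_forall fun x => ?_
  rw [Real.norm_of_nonneg (hb n x).1]
  exact (hb n x).2

lemma prob_ext {μ ν : Prob d}
    (h : ∀ f : Space d → ℝ, ContDiff ℝ ∞ f → HasCompactSupport f →
      ∫ x, f x ∂(μ : Measure (Space d)) = ∫ x, f x ∂(ν : Measure (Space d))) : μ = ν := by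
  refine Subtype.ext ?_
  change (μ : Measure (Space d)) = (ν : Measure (Space d))
  refine ext_of_generate_finite {U : Set (Space d) | IsOpen U} (BorelSpace.measurable_eq)
    isPiSystem_isOpen (fun U hU => ?_) (by simp)
  obtain ⟨f, hf, hfc, hb, hlim⟩ := exists_test_tendsto_indicator (d := d) hU
  have h1 := tendsto_integral_indicator hU (fun n => (hf n).continuous) hb hlim
    (μ : Measure (Space d))
  have h2 := tendsto_integral_indicator hU (fun n => (hf n).continuous) hb hlim
    (ν : Measure (Space d))
  simp_rw [h _ (hf _) (hfc _)] at h1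
  have := tendsto_nhds_unique h1 h2
  exact (measureReal_eq_measureReal_iff).1 this

/-- A bounded continuous function has a continuous integral. -/
lemma continuous_integral {f : Space d → ℝ} (hf : Continuous f) {C : ℝ} (hC : ∀ x, |f x| ≤ C) :
    Continuous fun μ : Prob d => ∫ x, f x ∂(μ : Measure (Space d)) := by
  rw [continuous_iff_continuousAt]
  intro μ
  exact ProbabilityMeasure.tendsto_iff_forall_integral_tendsto.1 tendsto_id
    (BoundedContinuousFunction.ofNormedAddCommGroup f hf C hC)

lemma continuous_integral_test {f : Space d → ℝ} (hf : ContDiff ℝ ∞ f)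
    (hfc : HasCompactSupport f) :
    Continuous fun μ : Prob d => ∫ x, f x ∂(μ : Measure (Space d)) := by
  obtain ⟨C, hC⟩ := hfc.exists_bound_of_continuous hf.continuous
  exact continuous_integral hf.continuous hC

/-- Makes a curve of measures a kernel, hence the time integrand measurable. -/
lemma measurable_toMeasure {c : ℝ → Prob d} (hc : Continuous c) :
    Measurable fun u => (c u : Measure (Space d)) := by
  refine Measurable.measure_of_isPiSystem_of_isProbabilityMeasure
    (S := {U : Set (Space d) | IsOpen U}) BorelSpace.measurable_eq isPiSystem_isOpen
    fun U hU => ?_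
  obtain ⟨f, hf, hfc, hb, hlim⟩ := exists_test_tendsto_indicator (d := d) hU
  have hreal : Measurable fun u => (c u : Measure (Space d)).real U := by
    refine measurable_of_tendsto_metrizable
      (f := fun n u => ∫ x, f n x ∂(c u : Measure (Space d))) (fun n => ?_)
      (tendsto_pi_nhds.2 fun u =>
        tendsto_integral_indicator hU (fun n => (hf n).continuous) hb hlim _)
    exact ((continuous_integral_test (hf n) (hfc n)).comp hc).measurable
  have := hreal.ennreal_ofReal
  simpa using this

/-- Convergence in a compact set of probability measures can be tested on smooth compactly
supported functions. -/
lemma tendsto_of_forall_test {ι : Type*} {l : Filter ι} {K : Set (Prob d)} (hK : IsCompact K)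
    {F : ι → Prob d} {μ : Prob d} (hF : ∀ᶠ i in l, F i ∈ K)
    (h : ∀ f : Space d → ℝ, ContDiff ℝ ∞ f → HasCompactSupport f →
      Tendsto (fun i => ∫ x, f x ∂(F i : Measure (Space d))) l
        (𝓝 (∫ x, f x ∂(μ : Measure (Space d))))) :
    Tendsto F l (𝓝 μ) := by
  -- By compactness it suffices that every cluster point is `μ`; its test integrals are those of
  -- `μ`.
  refine hK.tendsto_nhds_of_unique_mapClusterPt hF fun ρ _ hρ => prob_ext fun f hf hfc => ?_
  have h1 : MapClusterPt (∫ x, f x ∂(ρ : Measure (Space d))) l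
      (fun i => ∫ x, f x ∂(F i : Measure (Space d))) :=
    hρ.continuousAt_comp (continuous_integral_test hf hfc).continuousAt
  have : (𝓝 (∫ x, f x ∂(ρ : Measure (Space d))) ⊓
      𝓝 (∫ x, f x ∂(μ : Measure (Space d)))).NeBot :=
    NeBot.mono h1 (inf_le_inf_left _ (h f hf hfc))
  exact eq_of_nhds_neBot this

/-- Probability measures whose integrals of the cutoff functions tend to `1` at a prescribed
rate. -/
def cutoffBounded (d : ℕ) (u : ℕ → ℝ) : Set (Prob d) :=
  {μ | ∀ n, 1 - u n ≤ ∫ x, cutoff d n x ∂(μ : Measure (Space d))}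

/-- Prokhorov: the cutoff vanishes off the ball of radius `2 * (n + 1)`, so the mass outside is at
most `u n`. Closedness holds because test integrals are continuous. -/
lemma isCompact_cutoffBounded {u : ℕ → ℝ} (hu : Tendsto u atTop (𝓝 0)) :
    IsCompact (cutoffBounded d u) := by
  have hcomp := isCompact_setOfPred_probabilityMeasure_mass_eq_compl_isCompact_le
    (E := Space d) (u := fun n => (u n).toNNReal)
    (K := fun n => Metric.closedBall 0 (2 * ((n : ℝ) + 1)))
    (by simpa [Function.comp_def] using (continuous_real_toNNReal.tendsto 0).comp hu)
    (fun n => isCompact_closedBall _ _) (Or.inl inferInstance)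
  refine hcomp.of_isClosed_subset ?_ fun μ hμ n => ?_
  · simp only [cutoffBounded, ofPred_forall]
    exact isClosed_iInter fun n => isClosed_le continuous_const
      (continuous_integral_test (contDiff_cutoff n) (hasCompactSupport_cutoff n))
  · set B := Metric.closedBall (0 : Space d) (2 * ((n : ℝ) + 1)) with hB
    have hle : ∫ x, cutoff d n x ∂(μ : Measure (Space d)) ≤ (μ : Measure (Space d)).real B := by
      rw [← integral_indicator_one Metric.isClosed_closedBall.measurableSet]
      refine integral_mono_of_nonneg (Eventually.of_forall fun x => (cutoff_mem_Icc n x).1)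
        ((integrable_const (1 : ℝ)).indicator Metric.isClosed_closedBall.measurableSet)
        (Eventually.of_forall fun x => ?_)
      by_cases hx : x ∈ B
      · rw [indicator_of_mem hx]; exact (cutoff_mem_Icc n x).2
      · rw [indicator_of_notMem hx, cutoff_eq_zero]
        simpa using (not_le.1 (mt mem_closedBall_zero_iff.2 hx)).le
    have hcompl : (μ : Measure (Space d)).real Bᶜ = 1 - (μ : Measure (Space d)).real B :=
      probReal_compl_eq_one_sub Metric.isClosed_closedBall.measurableSet
    have h1 : (μ : Measure (Space d)).real Bᶜ ≤ u n := by
      have := hμ n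
      linarith
    refine NNReal.coe_le_coe.1 ?_
    exact h1.trans (Real.le_coe_toNNReal _)

end TestFunctions

end FPK

namespace FPK

open Set Filter Topology

/-! ### Bounds and measurability for the Kolmogorov operator -/

section Generator

variable {d : ℕ} {T : ℝ} {A : ℝ → Space d → Matrix (Fin d) (Fin d) ℝ}
  {b : ℝ → Space d → Fin d → ℝ}

lemma contDiff_partialDeriv {f : Space d → ℝ} (hf : ContDiff ℝ ∞ f) (i : Fin d) :
    ContDiff ℝ ∞ (partialDeriv i f) :=
  (hf.fderiv_right (m := ∞) (by simp)).clm_apply contDiff_const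

lemma hasCompactSupport_partialDeriv {f : Space d → ℝ} (hf : HasCompactSupport f) (i : Fin d) :
    HasCompactSupport (partialDeriv i f) :=
  hf.fderiv_apply (𝕜 := ℝ) _

lemma partialDeriv_comp_smul (f : Space d → ℝ) (r : ℝ) (i : Fin d) :
    partialDeriv i (fun x => f (r • x)) = fun x => r * partialDeriv i f (r • x) := by
  funext x
  simp only [partialDeriv]
  rw [fderiv_comp_smul]
  rfl

lemma partialDeriv_const_mul (f : Space d → ℝ) (r : ℝ) (i : Fin d) :
    partialDeriv i (fun x => r * f x) = fun x => r * partialDeriv i f x := by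
  funext x
  simp only [partialDeriv]
  change fderiv ℝ (r • f) x _ = _
  rw [fderiv_const_smul_field]
  rfl

/-- First and second order partial derivatives of `f` are bounded by `D`. -/
def DerivBound (f : Space d → ℝ) (D : ℝ) : Prop :=
  (∀ i x, |partialDeriv i f x| ≤ D) ∧ ∀ i j x, |partialDeriv i (partialDeriv j f) x| ≤ D

lemma exists_derivBound {f : Space d → ℝ} (hf : ContDiff ℝ ∞ f) (hfc : HasCompactSupport f) :
    ∃ D, 0 ≤ D ∧ DerivBound f D := by
  have h1 : ∀ i, ∃ C, ∀ x, |partialDeriv i f x| ≤ C := fun i =>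
    (hasCompactSupport_partialDeriv hfc i).exists_bound_of_continuous
      (contDiff_partialDeriv hf i).continuous
  have h2 : ∀ i j, ∃ C, ∀ x, |partialDeriv i (partialDeriv j f) x| ≤ C := fun i j =>
    (hasCompactSupport_partialDeriv
      (hasCompactSupport_partialDeriv hfc j) i).exists_bound_of_continuous
      (contDiff_partialDeriv (contDiff_partialDeriv hf j) i).continuous
  choose C₁ hC₁ using h1
  choose C₂ hC₂ using h2
  have p1 : ∀ i, 0 ≤ C₁ i := fun i => (abs_nonneg _).trans (hC₁ i 0)
  have p2 : ∀ i j, 0 ≤ C₂ i j := fun i j => (abs_nonneg _).trans (hC₂ i j 0)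
  have s1 : 0 ≤ ∑ i, C₁ i := Finset.sum_nonneg fun i _ => p1 i
  have s2 : 0 ≤ ∑ i, ∑ j, C₂ i j :=
    Finset.sum_nonneg fun i _ => Finset.sum_nonneg fun j _ => p2 i j
  refine ⟨(∑ i, C₁ i) + ∑ i, ∑ j, C₂ i j, add_nonneg s1 s2, fun i x => ?_, fun i j x => ?_⟩
  · have := Finset.single_le_sum (f := C₁) (fun i _ => p1 i) (Finset.mem_univ i)
    linarith [hC₁ i x]
  · have h3 := Finset.single_le_sum (f := C₂ i) (fun j _ => p2 i j) (Finset.mem_univ j)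
    have h4 := Finset.single_le_sum (f := fun i => ∑ j, C₂ i j)
      (fun i _ => Finset.sum_nonneg fun j _ => p2 i j) (Finset.mem_univ i)
    linarith [hC₂ i j x]

/-- Each derivative of the rescaled bump brings a factor `(n + 1)⁻¹`; one suffices. This decay
limits the mass escaping to infinity. -/
lemma exists_derivBound_cutoff (d : ℕ) :
    ∃ D, 0 ≤ D ∧ ∀ n : ℕ, DerivBound (cutoff d n) (((n : ℝ) + 1)⁻¹ * D) := by
  obtain ⟨D, hD0, h1, h2⟩ := exists_derivBound (contDiff_bump (d := d)) (bump d).hasCompactSupport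
  refine ⟨D, hD0, fun n => ?_⟩
  set r : ℝ := ((n : ℝ) + 1)⁻¹ with hr
  have hr0 : 0 ≤ r := by positivity
  have hr1 : r ≤ 1 := inv_le_one_of_one_le₀ (by linarith [n.cast_nonneg (α := ℝ)])
  have e1 : ∀ i, partialDeriv i (cutoff d n) = fun x => r * partialDeriv i (bump d) (r • x) :=
    fun i => partialDeriv_comp_smul _ r i
  have e2 : ∀ i j, partialDeriv i (partialDeriv j (cutoff d n)) =
      fun x => r * (r * partialDeriv i (partialDeriv j (bump d)) (r • x)) := fun i j => by
    rw [e1, partialDeriv_const_mul, partialDeriv_comp_smul]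
  refine ⟨fun i x => ?_, fun i j x => ?_⟩
  · rw [e1, abs_mul, abs_of_nonneg hr0]
    exact mul_le_mul_of_nonneg_left (h1 i _) hr0
  · rw [e2, abs_mul, abs_mul, abs_of_nonneg hr0]
    refine mul_le_mul_of_nonneg_left ?_ hr0
    exact (mul_le_of_le_one_left (abs_nonneg _) hr1).trans (h2 i j _)

lemma IsAdmissible.exists_bound (h : IsAdmissible T A b) :
    ∃ B, 0 ≤ B ∧ ∀ (f : Space d → ℝ) (D : ℝ), DerivBound f D → ∀ u ∈ Icc (0 : ℝ) T, ∀ x,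
      |kolmogorov A b u f x| ≤ B * D := by
  obtain ⟨C₁, h₁⟩ := h.bounded_diffusion
  obtain ⟨C₂, h₂⟩ := h.bounded_drift
  refine ⟨1 / 2 * ∑ _i : Fin d, ∑ _j : Fin d, |C₁| + ∑ _i : Fin d, |C₂|, by positivity,
    fun f D hD u hu x => ?_⟩
  rw [kolmogorov, add_mul, mul_assoc]
  simp only [Finset.sum_mul]
  refine (abs_add_le _ _).trans (add_le_add ?_ ?_)
  · rw [abs_mul, abs_of_pos (by norm_num : (0 : ℝ) < 1 / 2)]
    refine mul_le_mul_of_nonneg_left ?_ (by norm_num)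
    refine (Finset.abs_sum_le_sum_abs _ _).trans (Finset.sum_le_sum fun i _ => ?_)
    refine (Finset.abs_sum_le_sum_abs _ _).trans (Finset.sum_le_sum fun j _ => ?_)
    rw [abs_mul]
    exact mul_le_mul ((h₁ u hu x i j).trans (le_abs_self _)) (hD.2 i j x) (abs_nonneg _)
      (abs_nonneg _)
  · refine (Finset.abs_sum_le_sum_abs _ _).trans (Finset.sum_le_sum fun i _ => ?_)
    rw [abs_mul]
    exact mul_le_mul ((h₂ u hu x i).trans (le_abs_self _)) (hD.1 i x) (abs_nonneg _)
      (abs_nonneg _)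

lemma IsAdmissible.continuous_kolmogorov (h : IsAdmissible T A b) {f : Space d → ℝ}
    (hf : ContDiff ℝ ∞ f) {u : ℝ} (hu : u ∈ Icc (0 : ℝ) T) :
    Continuous (kolmogorov A b u f) := by
  unfold kolmogorov
  refine (continuous_const.mul (continuous_finsetSum _ fun i _ =>
    continuous_finsetSum _ fun j _ => ?_)).add (continuous_finsetSum _ fun i _ => ?_)
  · exact (h.continuous_diffusion u hu i j).mul
      (contDiff_partialDeriv (contDiff_partialDeriv hf j) i).continuous
  · exact (h.continuous_drift u hu i).mul (contDiff_partialDeriv hf i).continuous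

lemma IsAdmissible.measurable_kolmogorov (h : IsAdmissible T A b) {f : Space d → ℝ}
    (hf : ContDiff ℝ ∞ f) :
    Measurable fun p : Icc (0 : ℝ) T × Space d => kolmogorov A b (p.1 : ℝ) f p.2 := by
  unfold kolmogorov
  refine (measurable_const.mul (Finset.measurable_sum _ fun i _ =>
    Finset.measurable_sum _ fun j _ => ?_)).add (Finset.measurable_sum _ fun i _ => ?_)
  · exact (h.measurable_diffusion i j).mul
      ((contDiff_partialDeriv (contDiff_partialDeriv hf j) i).continuous.measurable.comp
        measurable_snd)
  · exact (h.measurable_drift i).mul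
      ((contDiff_partialDeriv hf i).continuous.measurable.comp measurable_snd)

/-- The integrand of the time integral in the Fokker-Planck equation. -/
noncomputable def rate (A : ℝ → Space d → Matrix (Fin d) (Fin d) ℝ)
    (b : ℝ → Space d → Fin d → ℝ) (f : Space d → ℝ) (c : ℝ → Prob d) (u : ℝ) : ℝ :=
  ∫ x, kolmogorov A b u f x ∂(c u : Measure (Space d))

lemma IsAdmissible.aestronglyMeasurable_rate (h : IsAdmissible T A b) {f : Space d → ℝ}
    (hf : ContDiff ℝ ∞ f) {c : ℝ → Prob d} (hc : Continuous c) {s t : ℝ}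
    (hs : s ∈ Icc (0 : ℝ) T) (ht : t ∈ Icc (0 : ℝ) T) :
    AEStronglyMeasurable (rate A b f c) (volume.restrict (uIoc s t)) := by
  have h0T : (0 : ℝ) ≤ T := hs.1.trans hs.2
  let κ : ProbabilityTheory.Kernel (Icc (0 : ℝ) T) (Space d) :=
    ⟨fun u => (c u : Measure (Space d)), (measurable_toMeasure hc).comp measurable_subtype_coe⟩
  have : ProbabilityTheory.IsMarkovKernel κ :=
    ⟨fun u => (inferInstance : IsProbabilityMeasure (c u : Measure (Space d)))⟩
  have hmeas : StronglyMeasurable fun u : Icc (0 : ℝ) T => rate A b f c u :=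
    StronglyMeasurable.integral_kernel_prod_right' (κ := κ)
      (h.measurable_kolmogorov hf).stronglyMeasurable
  -- Joint measurability is available only over `[0,T]`, so the integrand is extended by projection,
  -- which changes nothing on the interval of integration.
  have hproj : StronglyMeasurable fun u : ℝ => rate A b f c (projIcc 0 T h0T u) :=
    hmeas.comp_measurable (continuous_projIcc (h := h0T)).measurable
  refine hproj.aestronglyMeasurable.congr ?_
  filter_upwards [ae_restrict_mem measurableSet_uIoc] with u hu
  have : u ∈ Icc (0 : ℝ) T := uIcc_subset_Icc hs ht (uIoc_subset_uIcc hu)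
  rw [projIcc_of_mem h0T this]

lemma abs_integral_le_of_forall_le {f : Space d → ℝ} {C : ℝ} (hC : ∀ x, |f x| ≤ C) (μ : Prob d) :
    |∫ x, f x ∂(μ : Measure (Space d))| ≤ C := by
  have := norm_integral_le_of_norm_le_const (μ := (μ : Measure (Space d))) (f := f) (C := C)
    (Eventually.of_forall hC)
  simpa using this

end Generator

end FPK

namespace FPK

open Set Filter Topology

/-! ### Solutions: restriction, concatenation, compactness -/

section Solutions

variable {d : ℕ} {T : ℝ} {A : ℝ → Space d → Matrix (Fin d) (Fin d) ℝ}
  {b : ℝ → Space d → Fin d → ℝ}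

/-- Solutions of the Fokker-Planck equation on `[s,T]`, extended to curves on the real line that
are constant before `s` and after `T`. -/
structure IsSolution (A : ℝ → Space d → Matrix (Fin d) (Fin d) ℝ)
    (b : ℝ → Space d → Fin d → ℝ) (s : Icc (0 : ℝ) T) (ν : Prob d) (c : ℝ → Prob d) : Prop where
  continuous : Continuous c
  eq_of_le : ∀ t : ℝ, t ≤ s → c t = ν
  eq_of_ge : ∀ t : ℝ, T ≤ t → c t = c T
  equation : ∀ f : Space d → ℝ, ContDiff ℝ ∞ f → HasCompactSupport f → ∀ t ∈ Icc (s : ℝ) T,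
    ∫ x, f x ∂(c t : Measure (Space d)) - ∫ x, f x ∂(ν : Measure (Space d)) =
      ∫ u in (s : ℝ)..t, rate A b f c u

lemma IsAdmissible.intervalIntegrable_rate (h : IsAdmissible T A b) {f : Space d → ℝ}
    (hf : ContDiff ℝ ∞ f) (hfc : HasCompactSupport f) {c : ℝ → Prob d} (hc : Continuous c)
    {s t : ℝ} (hs : s ∈ Icc (0 : ℝ) T) (ht : t ∈ Icc (0 : ℝ) T) :
    IntervalIntegrable (rate A b f c) volume s t := by
  obtain ⟨B, -, hB⟩ := h.exists_bound
  obtain ⟨D, -, hD⟩ := exists_derivBound hf hfc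
  rw [intervalIntegrable_iff]
  refine Integrable.mono' (g := fun _ => B * D) (integrableOn_const (by simp))
    (h.aestronglyMeasurable_rate hf hc hs ht) ?_
  filter_upwards [ae_restrict_mem measurableSet_uIoc] with u hu
  exact abs_integral_le_of_forall_le
    (hB f D hD u (uIcc_subset_Icc hs ht (uIoc_subset_uIcc hu))) (c u)

namespace IsSolution

variable {s : Icc (0 : ℝ) T} {ν : Prob d} {c : ℝ → Prob d}

lemma sub_eq (hc : IsSolution A b s ν c) (h : IsAdmissible T A b) {f : Space d → ℝ}
    (hf : ContDiff ℝ ∞ f) (hfc : HasCompactSupport f) {t u : ℝ} (ht : t ∈ Icc (s : ℝ) T)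
    (hu : u ∈ Icc (s : ℝ) T) :
    ∫ x, f x ∂(c t : Measure (Space d)) - ∫ x, f x ∂(c u : Measure (Space d)) =
      ∫ v in u..t, rate A b f c v := by
  have h1 := hc.equation f hf hfc t ht
  have h2 := hc.equation f hf hfc u hu
  have hsub : Icc (s : ℝ) T ⊆ Icc 0 T := Icc_subset_Icc_left s.2.1
  have h3 := intervalIntegral.integral_add_adjacent_intervals
    (h.intervalIntegrable_rate hf hfc hc.continuous s.2 (hsub hu))
    (h.intervalIntegrable_rate hf hfc hc.continuous (hsub hu) (hsub ht))
  linarith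

lemma eq_projIcc (hc : IsSolution A b s ν c) (t : ℝ) : c t = c (projIcc (s : ℝ) T s.2.2 t) := by
  rcases le_total t s with h | h
  · rw [projIcc_of_le_left _ h, hc.eq_of_le t h, hc.eq_of_le s le_rfl]
  rcases le_total T t with h' | h'
  · rw [projIcc_of_right_le _ h', hc.eq_of_ge t h']
  · rw [projIcc_of_mem _ ⟨h, h'⟩]

/-- The constant does not depend on the solution, which gives both tightness and equicontinuity in
time. -/
lemma abs_sub_le (hc : IsSolution A b s ν c) (h : IsAdmissible T A b) {f : Space d → ℝ}
    (hf : ContDiff ℝ ∞ f) (hfc : HasCompactSupport f) {C : ℝ}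
    (hC : ∀ u ∈ Icc (0 : ℝ) T, ∀ x, |kolmogorov A b u f x| ≤ C) (t u : ℝ) :
    |∫ x, f x ∂(c t : Measure (Space d)) - ∫ x, f x ∂(c u : Measure (Space d))| ≤
      C * |t - u| := by
  have hC0 : 0 ≤ C := (abs_nonneg _).trans (hC s s.2 0)
  rw [hc.eq_projIcc t, hc.eq_projIcc u, hc.sub_eq h hf hfc (Subtype.prop _) (Subtype.prop _)]
  refine (intervalIntegral.norm_integral_le_of_norm_le_const (f := rate A b f c) (C := C)
    fun v hv => ?_).trans (mul_le_mul_of_nonneg_left (abs_projIcc_sub_projIcc _) hC0)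
  refine abs_integral_le_of_forall_le (hC v ?_) (c v)
  have := uIcc_subset_Icc (Subtype.prop _) (Subtype.prop _) (uIoc_subset_uIcc hv)
  exact ⟨s.2.1.trans this.1, this.2⟩

lemma restrict (hc : IsSolution A b s ν c) (h : IsAdmissible T A b) (r : Icc (0 : ℝ) T)
    (hsr : s ≤ r) : IsSolution A b r (c r) fun t => c (max r t) := by
  refine ⟨hc.continuous.comp (continuous_const.max continuous_id),
    fun t ht => by rw [max_eq_left ht], fun t ht => ?_, fun f hf hfc t ht => ?_⟩
  · rw [max_eq_right r.2.2, max_eq_right (r.2.2.trans ht), hc.eq_of_ge t ht]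
  · simp only [max_eq_right ht.1]
    rw [hc.sub_eq h hf hfc ⟨le_trans hsr ht.1, ht.2⟩ ⟨hsr, r.2.2⟩]
    refine intervalIntegral.integral_congr fun u hu => ?_
    rw [uIcc_of_le ht.1] at hu
    simp only [rate, max_eq_right hu.1]

lemma concat (hc : IsSolution A b s ν c) (h : IsAdmissible T A b) {r : Icc (0 : ℝ) T}
    (hsr : s ≤ r) {c' : ℝ → Prob d} (hc' : IsSolution A b r (c r) c') :
    IsSolution A b s ν (concat r c c') := by
  have hsr' : (s : ℝ) ≤ r := hsr
  have heq : ∀ t : ℝ, r ≤ t → FPK.concat r c c' t = c' t := by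
    intro t ht
    rcases ht.eq_or_lt with rfl | ht
    · rw [concat_of_le _ _ le_rfl, hc'.eq_of_le _ le_rfl]
    · exact concat_of_lt _ _ ht
  have hcont : Continuous (FPK.concat r c c') := by
    unfold FPK.concat
    refine hc.continuous.if_le hc'.continuous continuous_id continuous_const ?_
    rintro t rfl
    exact (hc'.eq_of_le _ le_rfl).symm
  have hle : ∀ f, ∀ t ∈ Icc (s : ℝ) r,
      ∫ u in (s : ℝ)..t, rate A b f (FPK.concat r c c') u = ∫ u in (s : ℝ)..t, rate A b f c u := by
    intro f t ht
    refine intervalIntegral.integral_congr fun u hu => ?_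
    rw [uIcc_of_le ht.1] at hu
    simp only [rate, concat_of_le c c' (hu.2.trans ht.2)]
  refine ⟨hcont, fun t ht => ?_, fun t ht => ?_, fun f hf hfc t ht => ?_⟩
  · rw [concat_of_le _ _ (ht.trans hsr'), hc.eq_of_le t ht]
  · rw [heq t (r.2.2.trans ht), heq T r.2.2, hc'.eq_of_ge t ht]
  · rcases le_total t r with htr | htr
    · rw [concat_of_le _ _ htr, hle f t ⟨ht.1, htr⟩, hc.equation f hf hfc t ht]
    · rw [heq t htr, ← intervalIntegral.integral_add_adjacent_intervals
        (h.intervalIntegrable_rate hf hfc hcont s.2 r.2)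
        (h.intervalIntegrable_rate hf hfc hcont r.2 ⟨r.2.1.trans htr, ht.2⟩),
        hle f r ⟨hsr, le_rfl⟩]
      have h1 := hc.equation f hf hfc r ⟨hsr, r.2.2⟩
      have h2 := hc'.equation f hf hfc t ⟨htr, ht.2⟩
      have h3 : ∫ u in (r : ℝ)..t, rate A b f (FPK.concat r c c') u =
          ∫ u in (r : ℝ)..t, rate A b f c' u := by
        refine intervalIntegral.integral_congr fun u hu => ?_
        rw [uIcc_of_le htr] at hu
        simp only [rate, heq u hu.1]
      linarith

end IsSolution

/-- All solutions started from `ν` take values in one compact set. -/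
lemma IsAdmissible.exists_isCompact (h : IsAdmissible T A b) (s : Icc (0 : ℝ) T) (ν : Prob d) :
    ∃ K : Set (Prob d), IsCompact K ∧ ∀ c, IsSolution A b s ν c → ∀ t, c t ∈ K := by
  obtain ⟨B, hB0, hB⟩ := h.exists_bound
  obtain ⟨D, hD0, hD⟩ := exists_derivBound_cutoff d
  -- The cutoff integral starts at `∫ cutoff d n dν` and changes at rate at most `B * ((n + 1)⁻¹ *
  -- D)` over a time at most `T`.
  refine ⟨cutoffBounded d fun n => (1 - ∫ x, cutoff d n x ∂(ν : Measure (Space d))) +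
    B * (((n : ℝ) + 1)⁻¹ * D) * T, isCompact_cutoffBounded ?_, fun c hc t n => ?_⟩
  · have h1 : Tendsto (fun n => ∫ x, cutoff d n x ∂(ν : Measure (Space d))) atTop (𝓝 1) := by
      simpa using tendsto_integral_indicator isOpen_univ
        (fun n => (contDiff_cutoff n).continuous) cutoff_mem_Icc
        (by simpa using tendsto_cutoff (d := d)) (ν : Measure (Space d))
    have h2 : Tendsto (fun n : ℕ => ((n : ℝ) + 1)⁻¹) atTop (𝓝 0) := by
      simpa [one_div] using tendsto_one_div_add_atTop_nhds_zero_nat (𝕜 := ℝ)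
    have h3 := (tendsto_const_nhds (x := (1 : ℝ))).sub h1 |>.add
      (((h2.mul_const D).const_mul B).mul_const T)
    simpa using h3
  · have h1 := hc.abs_sub_le h (contDiff_cutoff n) (hasCompactSupport_cutoff n)
      (hB _ _ (hD n)) (projIcc (s : ℝ) T s.2.2 t) s
    rw [← hc.eq_projIcc, hc.eq_of_le s le_rfl] at h1
    have hmem := (projIcc (s : ℝ) T s.2.2 t).2
    have h2 : |(projIcc (s : ℝ) T s.2.2 t : ℝ) - s| ≤ T := by
      rw [abs_of_nonneg (sub_nonneg.2 hmem.1)]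
      linarith [hmem.2, s.2.1]
    have h3 := mul_le_mul_of_nonneg_left h2
      (show 0 ≤ B * (((n : ℝ) + 1)⁻¹ * D) by positivity)
    have h4 := (abs_le.1 h1).1
    linarith

/-- Pointwise limits of solutions, where the convergence is only assumed on a dense set of times,
exist and are solutions. -/
lemma IsAdmissible.exists_limit (h : IsAdmissible T A b) {s : Icc (0 : ℝ) T} {ν : Prob d}
    {c : ℕ → ℝ → Prob d} (hc : ∀ n, IsSolution A b s ν (c n)) {Q : Set ℝ} (hQ : Dense Q)
    {p : Q → Prob d} (hp : ∀ q : Q, Tendsto (fun n => c n q) atTop (𝓝 (p q))) :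
    ∃ c₀, IsSolution A b s ν c₀ ∧ ∀ t, Tendsto (fun n => c n t) atTop (𝓝 (c₀ t)) := by
  obtain ⟨K, hK, hcK⟩ := h.exists_isCompact s ν
  have hbound : ∀ f : Space d → ℝ, ContDiff ℝ ∞ f → HasCompactSupport f →
      ∃ C, ∀ u ∈ Icc (0 : ℝ) T, ∀ x, |kolmogorov A b u f x| ≤ C := by
    intro f hf hfc
    obtain ⟨B, -, hB⟩ := h.exists_bound
    obtain ⟨D, -, hD⟩ := exists_derivBound hf hfc
    exact ⟨B * D, hB f D hD⟩
  have hcauchy : ∀ f : Space d → ℝ, ContDiff ℝ ∞ f → HasCompactSupport f → ∀ t,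
      CauchySeq fun n => ∫ x, f x ∂(c n t : Measure (Space d)) := by
    intro f hf hfc t
    obtain ⟨C, hC⟩ := hbound f hf hfc
    have hC0 : 0 ≤ C := (abs_nonneg _).trans (hC s s.2 0)
    rw [Metric.cauchySeq_iff']
    intro ε hε
    -- Three-epsilon argument through a nearby `q ∈ Q`; `C + 1` avoids dividing by zero.
    obtain ⟨q, hq, hqt⟩ := hQ.exists_dist_lt t (show 0 < ε / (3 * (C + 1)) by positivity)
    have hclose : ∀ n, |∫ x, f x ∂(c n t : Measure (Space d)) -
        ∫ x, f x ∂(c n q : Measure (Space d))| ≤ ε / 3 := by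
      intro n
      refine ((hc n).abs_sub_le h hf hfc hC t q).trans ?_
      rw [Real.dist_eq] at hqt
      calc C * |t - q| ≤ (C + 1) * (ε / (3 * (C + 1))) :=
            mul_le_mul (by linarith) hqt.le (abs_nonneg _) (by linarith)
        _ = ε / 3 := by field_simp
    have hcq := (((continuous_integral_test hf hfc).tendsto _).comp (hp ⟨q, hq⟩)).cauchySeq
    obtain ⟨N, hN⟩ := Metric.cauchySeq_iff'.1 hcq (ε / 3) (by positivity)
    refine ⟨N, fun n hn => ?_⟩
    have h1 := hN n hn
    simp only [Function.comp, Real.dist_eq] at h1 ⊢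
    have h2 := abs_lt.1 h1
    have h3 := abs_le.1 (hclose n)
    have h4 := abs_le.1 (hclose N)
    rw [abs_lt]
    constructor <;> linarith
  have hlim : ∀ t, ∃ μ ∈ K, Tendsto (fun n => c n t) atTop (𝓝 μ) := by
    intro t
    obtain ⟨μ, hμK, hμ⟩ := hK.exists_mapClusterPt (u := fun n => c n t) (f := atTop)
      (tendsto_principal.2 (Eventually.of_forall fun n => hcK _ (hc n) t))
    refine ⟨μ, hμK, tendsto_of_forall_test hK (Eventually.of_forall fun n => hcK _ (hc n) t)
      fun f hf hfc => ?_⟩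
    refine le_nhds_of_cauchy_adhp (hcauchy f hf hfc t) ?_
    exact hμ.continuousAt_comp (continuous_integral_test hf hfc).continuousAt
  choose c₀ hc₀K hc₀ using hlim
  have hint : ∀ f : Space d → ℝ, ContDiff ℝ ∞ f → HasCompactSupport f → ∀ t,
      Tendsto (fun n => ∫ x, f x ∂(c n t : Measure (Space d))) atTop
        (𝓝 (∫ x, f x ∂(c₀ t : Measure (Space d)))) := fun f hf hfc t =>
    ((continuous_integral_test hf hfc).tendsto _).comp (hc₀ t)
  refine ⟨c₀, ⟨?_, fun t ht => ?_, fun t ht => ?_, fun f hf hfc t ht => ?_⟩, hc₀⟩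
  · rw [continuous_iff_continuousAt]
    intro t
    refine tendsto_of_forall_test hK (Eventually.of_forall hc₀K) fun f hf hfc => ?_
    obtain ⟨C, hC⟩ := hbound f hf hfc
    have hle : ∀ u, |∫ x, f x ∂(c₀ u : Measure (Space d)) -
        ∫ x, f x ∂(c₀ t : Measure (Space d))| ≤ C * |u - t| := fun u =>
      le_of_tendsto ((hint f hf hfc u).sub (hint f hf hfc t)).abs
        (Eventually.of_forall fun n => (hc n).abs_sub_le h hf hfc hC u t)
    rw [tendsto_iff_dist_tendsto_zero]
    refine squeeze_zero (fun _ => dist_nonneg) hle ?_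
    have : Continuous fun u : ℝ => C * |u - t| := by fun_prop
    simpa using this.tendsto t
  · refine tendsto_nhds_unique (hc₀ t) (tendsto_const_nhds.congr fun n => ?_)
    exact ((hc n).eq_of_le t ht).symm
  · exact tendsto_nhds_unique (hc₀ t) ((hc₀ T).congr fun n => ((hc n).eq_of_ge t ht).symm)
  · obtain ⟨C, hC⟩ := hbound f hf hfc
    have htT : t ∈ Icc (0 : ℝ) T := ⟨s.2.1.trans ht.1, ht.2⟩
    have hsub : ∀ u ∈ uIoc (s : ℝ) t, u ∈ Icc (0 : ℝ) T := fun u hu =>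
      uIcc_subset_Icc s.2 htT (uIoc_subset_uIcc hu)
    refine tendsto_nhds_unique ((hint f hf hfc t).sub_const _) ?_
    simp_rw [(hc _).equation f hf hfc t ht]
    refine intervalIntegral.tendsto_integral_filter_of_dominated_convergence (fun _ => C)
      (Eventually.of_forall fun n =>
        h.aestronglyMeasurable_rate hf (hc n).continuous s.2 htT)
      (Eventually.of_forall fun n => Eventually.of_forall fun u hu =>
        abs_integral_le_of_forall_le (hC u (hsub u hu)) (c n u))
      intervalIntegrable_const (Eventually.of_forall fun u hu => ?_)
    -- Continuity of the coefficients in `x` enters here: `L_u f` is bounded and continuous, so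
    -- narrow convergence applies at each time `u`.
    exact ((continuous_integral (h.continuous_kolmogorov hf (hsub u hu))
      (hC u (hsub u hu))).tendsto _).comp (hc₀ u)

/-- Sequences do not detect compactness in the product over all real times. Restriction `R` to a
countable dense set `Q` lands in a metrizable product and is injective on continuous curves. By
`exists_limit` its image is sequentially closed, hence compact, and its inverse there is
sequentially continuous, so compactness transfers back. -/
lemma IsAdmissible.isCompact_solutions (h : IsAdmissible T A b) (s : Icc (0 : ℝ) T)
    (ν : Prob d) : IsCompact {c | IsSolution A b s ν c} := by
  obtain ⟨K, hK, hcK⟩ := h.exists_isCompact s ν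
  obtain ⟨Q, hQc, hQ⟩ := TopologicalSpace.exists_countable_dense ℝ
  have : Countable Q := hQc
  let R : (ℝ → Prob d) → Q → Prob d := fun c q => c q
  have hinj : InjOn R {c | IsSolution A b s ν c} := fun c hc c' hc' hR =>
    Continuous.ext_on hQ hc.continuous hc'.continuous fun q hq => congrFun hR ⟨q, hq⟩
  have hR : IsCompact (R '' {c | IsSolution A b s ν c}) := by
    refine (isCompact_univ_pi fun _ : Q => hK).of_isClosed_subset ?_ ?_
    · refine IsSeqClosed.isClosed fun y p hy hyp => ?_
      choose c hc hcy using hy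
      obtain ⟨c₀, hc₀, hlim⟩ := h.exists_limit hc hQ (p := p) fun q => by
        simpa [← hcy] using! (tendsto_pi_nhds.1 hyp q)
      refine ⟨c₀, hc₀, funext fun q => tendsto_nhds_unique (hlim q) ?_⟩
      simpa [← hcy] using! (tendsto_pi_nhds.1 hyp q)
    · rintro _ ⟨c, hc, rfl⟩ q -
      exact hcK c hc q
  have hcont : ContinuousOn (Function.invFunOn R {c | IsSolution A b s ν c})
      (R '' {c | IsSolution A b s ν c}) := by
    rw [continuousOn_iff_continuous_domRestrict, continuous_iff_seqContinuous]
    intro y p hyp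
    have hmem : ∀ z : R '' {c | IsSolution A b s ν c},
        IsSolution A b s ν (Function.invFunOn R {c | IsSolution A b s ν c} z) ∧
          R (Function.invFunOn R {c | IsSolution A b s ν c} z) = z := fun z =>
      ⟨Function.invFunOn_mem z.2, Function.invFunOn_eq z.2⟩
    have hyq : ∀ q, Tendsto (fun n => (y n : Q → Prob d) q) atTop (𝓝 ((p : Q → Prob d) q)) :=
      tendsto_pi_nhds.1 ((continuous_subtype_val.tendsto p).comp hyp)
    obtain ⟨c₀, hc₀, hlim⟩ := h.exists_limit (fun n => (hmem (y n)).1) hQ (p := p) fun q =>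
      (hyq q).congr fun n => (congrFun (hmem (y n)).2 q).symm
    have : c₀ = Function.invFunOn R {c | IsSolution A b s ν c} p := by
      refine hinj hc₀ (hmem p).1 ?_
      rw [(hmem p).2]
      exact funext fun q => tendsto_nhds_unique (hlim q)
        ((hyq q).congr fun n => (congrFun (hmem (y n)).2 q).symm)
    simp only [domRestrict_apply, Function.comp_def]
    rw [← this]
    exact tendsto_pi_nhds.2 hlim
  have := hR.image_of_continuousOn hcont
  rwa [hinj.invFunOn_image subset_rfl] at this

end Solutions

end FPK

namespace FPK

open Set Filter Topology

/-! ### Flows of solutions and uniqueness -/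

section Flows

variable {d : ℕ} {T : ℝ} {A : ℝ → Space d → Matrix (Fin d) (Fin d) ℝ}
  {b : ℝ → Space d → Fin d → ℝ}

lemma isSolution_comp_projIcc {s : Icc (0 : ℝ) T} {ν : Prob d} {μ : C(Icc (s : ℝ) T, Prob d)}
    (hμ : μ ∈ FP A b s ν) : IsSolution A b s ν fun t => μ (projIcc (s : ℝ) T s.2.2 t) := by
  refine ⟨μ.continuous.comp continuous_projIcc, fun t ht => ?_, fun t ht => ?_,
    fun f hf hfc t ht => ?_⟩
  · rw [projIcc_of_le_left _ ht]
    exact hμ.1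
  · rw [projIcc_of_right_le _ ht, projIcc_right]
  · rw [projIcc_of_mem _ ht]
    exact hμ.2 f hf hfc ⟨t, ht⟩

/-- The restriction of a solution to `[s,T]`. -/
def IsSolution.toContinuousMap {s : Icc (0 : ℝ) T} {ν : Prob d} {c : ℝ → Prob d}
    (hc : IsSolution A b s ν c) : C(Icc (s : ℝ) T, Prob d) :=
  ⟨fun t => c t, hc.continuous.comp continuous_subtype_val⟩

lemma IsSolution.toContinuousMap_mem_FP {s : Icc (0 : ℝ) T} {ν : Prob d} {c : ℝ → Prob d}
    (hc : IsSolution A b s ν c) : hc.toContinuousMap ∈ FP A b s ν := by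
  refine ⟨hc.eq_of_le s le_rfl, fun f hf hfc t => ?_⟩
  refine (hc.equation f hf hfc t t.2).trans ?_
  refine intervalIntegral.integral_congr fun u _ => ?_
  simp only [rate]
  rw [hc.eq_projIcc u]
  rfl

lemma IsAdmissible.isStable_solutions (h : IsAdmissible T A b)
    (hne : ∀ (s : Icc (0 : ℝ) T) (ν : Prob d), (FP A b s ν).Nonempty) :
    IsStable {p : Icc (0 : ℝ) T × Prob d × (ℝ → Prob d) | IsSolution A b p.1 p.2.1 p.2.2} where
  eq_of_le hc := IsSolution.eq_of_le hc
  isCompact s ν := h.isCompact_solutions s ν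
  nonempty s ν := let ⟨_, hμ⟩ := hne s ν; ⟨_, isSolution_comp_projIcc hμ⟩
  restrict hc r hsr := IsSolution.restrict hc h r hsr
  concat hc hsr hc' := IsSolution.concat hc h hsr hc'

/-- Any continuous functional of the solution at a given time is maximized along some flow. -/
lemma IsAdmissible.exists_isFlow_maximizing (h : IsAdmissible T A b)
    (hne : ∀ (s : Icc (0 : ℝ) T) (ν : Prob d), (FP A b s ν).Nonempty) (q : ℝ)
    {J : Prob d → ℝ} (hJ : Continuous J) :
    ∃ γ : CurveFamily d T, IsFlow A b γ ∧ ∀ s ν, ∀ μ ∈ FP A b s ν, ∀ hq : q ∈ Icc (s : ℝ) T,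
      J (μ ⟨q, hq⟩) ≤ J (γ s ν ⟨q, hq⟩) := by
  obtain ⟨g, hg, hflow⟩ := ((h.isStable_solutions hne).maximizers q hJ).exists_flow
  have hsol : ∀ s ν, IsSolution A b s ν (g s ν) := fun s ν => (hg s ν).1
  refine ⟨fun s ν => (hsol s ν).toContinuousMap,
    ⟨fun s ν => (hsol s ν).toContinuousMap_mem_FP, fun s r t hsr hrt ν => ?_⟩,
    fun s ν μ hμ hq => ?_⟩
  · have := congrFun (hflow s r hsr ν) t
    rw [max_eq_right (show (r : ℝ) ≤ t from hrt)] at this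
    exact this.symm
  · have := (hg s ν).2 _ (isSolution_comp_projIcc hμ)
    simp only [projIcc_of_mem _ hq] at this
    exact this

lemma IsAdmissible.FP_subsingleton_of_existsUnique (h : IsAdmissible T A b)
    (hne : ∀ (s : Icc (0 : ℝ) T) (ν : Prob d), (FP A b s ν).Nonempty)
    (huniq : ∃! γ : CurveFamily d T, IsFlow A b γ) (s : Icc (0 : ℝ) T) (ν : Prob d) :
    (FP A b s ν).Subsingleton := by
  intro μ hμ μ' hμ'
  ext1 t
  refine prob_ext fun f hf hfc => ?_
  have hJ := continuous_integral_test (d := d) hf hfc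
  obtain ⟨γ₁, hγ₁, h₁⟩ := h.exists_isFlow_maximizing hne t hJ
  obtain ⟨γ₂, hγ₂, h₂⟩ := h.exists_isFlow_maximizing hne t hJ.neg
  -- The single flow both maximizes and minimizes `∫ f dμ_t`, which squeezes the values of `μ` and
  -- `μ'` together.
  obtain rfl := huniq.unique hγ₁ hγ₂
  have a1 := h₁ s ν μ hμ t.2
  have a2 := h₁ s ν μ' hμ' t.2
  have a3 := h₂ s ν μ hμ t.2
  have a4 := h₂ s ν μ' hμ' t.2
  simp only [Subtype.coe_eta, Pi.neg_apply] at a1 a2 a3 a4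
  linarith

lemma IsAdmissible.existsUnique_isFlow (h : IsAdmissible T A b)
    (hne : ∀ (s : Icc (0 : ℝ) T) (ν : Prob d), (FP A b s ν).Nonempty)
    (hsub : ∀ (s : Icc (0 : ℝ) T) (ν : Prob d), (FP A b s ν).Subsingleton) :
    ∃! γ : CurveFamily d T, IsFlow A b γ := by
  -- Only the existence of a flow is wanted, so the functional is trivial.
  obtain ⟨γ, hγ, -⟩ := h.exists_isFlow_maximizing hne 0 (continuous_const (y := (0 : ℝ)))
  exact ⟨γ, hγ, fun γ' hγ' => funext fun s => funext fun ν =>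
    hsub s ν (hγ'.mem_FP s ν) (hγ.mem_FP s ν)⟩

end Flows

end FPK

theorem theorem3p16 {d : ℕ} {T : ℝ} (hT : 0 < T)
    (A : ℝ → FPK.Space d → Matrix (Fin d) (Fin d) ℝ) (b : ℝ → FPK.Space d → Fin d → ℝ)
    (hcoeff : FPK.IsAdmissible T A b)
    (hne : ∀ (s : Set.Icc (0 : ℝ) T) (ν : FPK.Prob d), (FPK.FP A b s ν).Nonempty) :
    (∀ (s : Set.Icc (0 : ℝ) T) (ν : FPK.Prob d), (FPK.FP A b s ν).encard = 1) ↔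
      ∃! γ : FPK.CurveFamily d T, FPK.IsFlow A b γ := by
  simp only [Set.encard_eq_one]
  refine ⟨fun h => hcoeff.existsUnique_isFlow hne fun s ν => ?_, fun h s ν => ?_⟩
  · obtain ⟨μ, hμ⟩ := h s ν
    exact hμ ▸ Set.subsingleton_singleton
  · exact Set.exists_eq_singleton_iff_nonempty_subsingleton.2
      ⟨hne s ν, hcoeff.FP_subsingleton_of_existsUnique hne h s ν⟩
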